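/- Let $M$ be a set of $n$ men and $W$ a set of $n$ women, where every man has a preference list (a strict total order) over $W$ and every woman has a preference list over $M$; let $\succ$ denote the resulting preference profile. For a profile $\succ$, let $\mathrm{DA}(\succ)$ be the perfect matching computed by the men-proposing deferred acceptance algorithm: in each round every currently unmatched man proposes to his favorite woman among those who have not rejected him yet, every woman then tentatively accepts her favorite proposal received so far and rejects the others, and the algorithm stops when no further proposals can be made. Fix a woman $w \in W$, and let $(\succ_{-w}, L)$ denote the profile obtained from $\succ$ by replacing $w$'s list $\succ_w$ by the list $L$. Let $$S_w := \{ (m_i, m_j, \succ_w \setminus \{m_i, m_j\}) : m_i, m_j \in M,\ m_i \neq m_j \}$$ be the set of lists obtained from $\succ_w$ by moving some two men to the top two positions, in either order, and leaving the relative order of all other men unchanged (if $n = 1$, then $S_w := \{\succ_w\}$). Lemma. For every preference list $\succ'_w$ over $M$ (an arbitrary misreport by $w$), there is a list $\succ''_w \in S_w$ such that $$\mathrm{DA}(\succ_{-w}, \succ''_w) = \mathrm{DA}(\succ_{-w}, \succ'_w).$$ -/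

import Mathlib

/-- A preference list over a finite set `α` : a strict total order on `α`, written as the list of all
elements of `α`, each exactly once, from the most preferred to the least preferred one. -/
@[ext]
structure PrefList (α : Type*) where
  toList : List α
  nodup : toList.Nodup
  complete : ∀ a, a ∈ toList

/-- The most preferred element, with respect to `L`, of the set of all `a` with `p a`
(`none` if there is no such `a`). -/
def PrefList.favorite {α : Type*} (L : PrefList α) (p : α → Prop) [DecidablePred p] : Option α :=
  L.toList.find? (fun a => decide (p a))

/-- A preference profile: one preference list over the women for every man, and one preference list
over the men for every woman. -/
structure PrefProfile (M W : Type*) where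
  men : M → PrefList W
  women : W → PrefList M

/-- The profile in which woman `w` submits the list `L` and everybody else's list is unchanged. -/
def PrefProfile.replaceWoman {M W : Type*} [DecidableEq W] (P : PrefProfile M W) (w : W)
    (L : PrefList M) : PrefProfile M W where
  men := P.men
  women := Function.update P.women w L

/-- The lists `(p, q, L \ {p, q})`, obtained from `L` by moving a pair of men `p`, `q` to the top two
positions (in this order) and leaving the relative order of all the others unchanged.
The two men are distinct, except that if there is only one man, then `p = q` is allowed and
the result is the one-element list. -/
def topTwoLists {M : Type*} [Fintype M] [DecidableEq M] (L : PrefList M) : Set (PrefList M) :=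
  {L' | ∃ p q : M, (2 ≤ Fintype.card M → p ≠ q) ∧
    L'.toList = [p, q].dedup ++ L.toList.filter (fun m => decide (m ≠ p ∧ m ≠ q))}

namespace DeferredAcceptance

/-! The state of the men-proposing deferred acceptance algorithm is the set `S` of all proposals
`(m, w)` (man `m` has proposed to woman `w`) that have been made so far. -/

variable {M W : Type*} [Fintype M] [Fintype W] [DecidableEq M] [DecidableEq W]

/-- The man who is tentatively accepted by `w`: her favorite among all the men who have proposed
to her so far. -/
def holds (P : PrefProfile M W) (S : Finset (M × W)) (w : W) : Option M :=
  (P.women w).favorite (fun m => (m, w) ∈ S)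

/-- `w` has rejected `m`: he has proposed to her and is not the man whom she holds. -/
def Rejected (P : PrefProfile M W) (S : Finset (M × W)) (m : M) (w : W) : Prop :=
  (m, w) ∈ S ∧ holds P S w ≠ some m

/-- No woman currently holds `m`. -/
def Unmatched (P : PrefProfile M W) (S : Finset (M × W)) (m : M) : Prop :=
  ∀ w, holds P S w ≠ some m

instance (P : PrefProfile M W) (S : Finset (M × W)) (m : M) :
    DecidablePred (fun w => ¬ Rejected P S m w) :=
  fun w => inferInstanceAs (Decidable (¬ ((m, w) ∈ S ∧ holds P S w ≠ some m)))

instance (P : PrefProfile M W) (S : Finset (M × W)) : DecidablePred (Unmatched P S) :=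
  fun m => inferInstanceAs (Decidable (∀ w, holds P S w ≠ some m))

/-- The proposals of the next proposal phase: every currently unmatched man proposes to his favorite
woman among those who have not rejected him yet. -/
def newProposals (P : PrefProfile M W) (S : Finset (M × W)) : Finset (M × W) :=
  Finset.univ.filter (fun x => Unmatched P S x.1 ∧
    (P.men x.1).favorite (fun w => ¬ Rejected P S x.1 w) = some x.2)

/-- The set of proposals made during the first `k` rounds. -/
def proposalsAfter (P : PrefProfile M W) : ℕ → Finset (M × W)
  | 0 => ∅
  | k + 1 => proposalsAfter P k ∪ newProposals P (proposalsAfter P k)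

theorem mem_newProposals {P : PrefProfile M W} {S : Finset (M × W)} {m : M} {w : W} :
    (m, w) ∈ newProposals P S ↔ Unmatched P S m ∧
      (P.men m).favorite (fun w => ¬ Rejected P S m w) = some w := by
  simp [newProposals]

theorem not_mem_of_mem_newProposals {P : PrefProfile M W} {S : Finset (M × W)} {x : M × W}
    (hx : x ∈ newProposals P S) : x ∉ S := by
  obtain ⟨m, w⟩ := x
  obtain ⟨hu, hf⟩ := mem_newProposals.1 hx
  have h := List.find?_some hf
  intro hS
  simp only [decide_eq_true_eq] at h
  exact h ⟨hS, hu w⟩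

/-- The algorithm terminates: after finitely many rounds there is no further proposal. -/
theorem exists_newProposals_eq_empty (P : PrefProfile M W) :
    ∃ k, newProposals P (proposalsAfter P k) = ∅ := by
  by_contra! h
  have key : ∀ k, k ≤ (proposalsAfter P k).card := by
    intro k
    induction k with
    | zero => simp
    | succ k ih =>
      have hd : Disjoint (proposalsAfter P k) (newProposals P (proposalsAfter P k)) :=
        Finset.disjoint_right.2 fun x hx => not_mem_of_mem_newProposals hx
      have hpos := Finset.card_pos.2 (h k)
      rw [proposalsAfter, Finset.card_union_of_disjoint hd]
      omega
  have h1 := key (Fintype.card (M × W) + 1)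
  have h2 := Finset.card_le_univ (proposalsAfter P (Fintype.card (M × W) + 1))
  omega

/-- The set of all proposals made during the run of the algorithm on the profile `P`, which ends
as soon as no further proposal can be made. -/
def finalProposals (P : PrefProfile M W) : Finset (M × W) :=
  proposalsAfter P (Nat.find (exists_newProposals_eq_empty P))

theorem newProposals_finalProposals (P : PrefProfile M W) :
    newProposals P (finalProposals P) = ∅ :=
  Nat.find_spec (exists_newProposals_eq_empty P)

theorem mem_of_holds {P : PrefProfile M W} {S : Finset (M × W)} {m : M} {w : W}
    (h : holds P S w = some m) : (m, w) ∈ S := by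
  simpa using List.find?_some h

theorem holds_of_subset {P : PrefProfile M W} {S T : Finset (M × W)} (hST : S ⊆ T) {m : M} {w : W}
    (h : holds P T w = some m) (hm : (m, w) ∈ S) : holds P S w = some m := by
  unfold holds PrefList.favorite at h ⊢
  rw [List.find?_eq_some_iff_append] at h ⊢
  obtain ⟨_, as, bs, h2, h3⟩ := h
  refine ⟨by simpa using hm, as, bs, h2, fun a ha => ?_⟩
  have := h3 a ha
  simp only [Bool.not_eq_true', decide_eq_false_iff_not] at this ⊢
  exact fun hS => this (hST hS)

theorem holds_injective_after (P : PrefProfile M W) (k : ℕ) {m : M} {w w' : W}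
    (h : holds P (proposalsAfter P k) w = some m) (h' : holds P (proposalsAfter P k) w' = some m) :
    w = w' := by
  induction k with
  | zero => simpa [proposalsAfter] using mem_of_holds h
  | succ k ih =>
    have hsub : proposalsAfter P k ⊆ proposalsAfter P (k + 1) := Finset.subset_union_left
    rcases Finset.mem_union.1 (mem_of_holds h) with h1 | h1 <;>
      rcases Finset.mem_union.1 (mem_of_holds h') with h2 | h2
    · exact ih (holds_of_subset hsub h h1) (holds_of_subset hsub h' h2)
    · exact absurd (holds_of_subset hsub h h1) ((mem_newProposals.1 h2).1 w)
    · exact absurd (holds_of_subset hsub h' h2) ((mem_newProposals.1 h1).1 w')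
    · exact Option.some.inj ((mem_newProposals.1 h1).2.symm.trans (mem_newProposals.1 h2).2)

/-- When the algorithm ends, every man is held by some woman, provided that there are as many men as
women. -/
theorem exists_holds_finalProposals (hcard : Fintype.card M = Fintype.card W)
    (P : PrefProfile M W) (m : M) : ∃ w, holds P (finalProposals P) w = some m := by
  by_contra! hm
  have hrej : ∀ w, Rejected P (finalProposals P) m w := by
    intro w
    by_contra hw
    cases hf : (P.men m).favorite (fun w => ¬ Rejected P (finalProposals P) m w) with
    | none =>
      have := List.find?_eq_none.1 hf w ((P.men m).complete w)
      simp only [decide_eq_true_eq] at this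
      exact this hw
    | some v =>
      have hv : (m, v) ∈ newProposals P (finalProposals P) := mem_newProposals.2 ⟨hm, hf⟩
      rw [newProposals_finalProposals] at hv
      simp at hv
  have hheld : ∀ w, ∃ m', holds P (finalProposals P) w = some m' := by
    intro w
    cases hf : holds P (finalProposals P) w with
    | none =>
      have := List.find?_eq_none.1 hf m ((P.women w).complete m)
      simp only [decide_eq_true_eq] at this
      exact absurd (hrej w).1 this
    | some v => exact ⟨v, rfl⟩
  choose f hf using hheld
  have hinj : Function.Injective f := fun w w' hww =>
    holds_injective_after P _ (hf w) (hww ▸ hf w')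
  obtain ⟨w, hw⟩ := ((Fintype.bijective_iff_injective_and_card f).2 ⟨hinj, hcard.symm⟩).2 m
  exact hm w (hw ▸ hf w)

/-- The woman to whom the algorithm assigns the man `m`: the one who holds him at the end. -/
noncomputable def partner (hcard : Fintype.card M = Fintype.card W) (P : PrefProfile M W)
    (m : M) : W :=
  (exists_holds_finalProposals hcard P m).choose

theorem holds_partner (hcard : Fintype.card M = Fintype.card W) (P : PrefProfile M W) (m : M) :
    holds P (finalProposals P) (partner hcard P m) = some m :=
  (exists_holds_finalProposals hcard P m).choose_spec

theorem partner_bijective (hcard : Fintype.card M = Fintype.card W) (P : PrefProfile M W) :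
    Function.Bijective (partner hcard P) := by
  refine (Fintype.bijective_iff_injective_and_card _).2 ⟨fun m m' h => ?_, hcard⟩
  have h1 := holds_partner hcard P m
  rw [h, holds_partner hcard P m'] at h1
  exact (Option.some.inj h1).symm

end DeferredAcceptance

/-- The matching computed by the men-proposing deferred acceptance algorithm on the profile `P`, as
a bijection from the men to the women: `m` is matched to the woman who holds him at the end. -/
noncomputable def deferredAcceptance {M W : Type*} [Fintype M] [Fintype W] [DecidableEq M]
    [DecidableEq W] (hcard : Fintype.card M = Fintype.card W) (P : PrefProfile M W) : M ≃ W :=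
  Equiv.ofBijective (DeferredAcceptance.partner hcard P)
    (DeferredAcceptance.partner_bijective hcard P)

/-! The set of all proposals made is the least set closed under "a man proposes to a woman once all
women he prefers have rejected him" (`finalProposals_subset_of_step_subset`), and it determines the
matching (`partner_eq_of_finalProposals_eq`). So it is enough that the misreport `L'` and the
two-man list produce the same proposals. The two men are the partner `p` of `w` under `L'` and her
second favorite proposer `x`, by `L'`.

Proposals under the new list are proposals under `L'`, because `p` eventually displaces everyone
else there. The converse is direct once `p` or `x` proposes to `w` under the new list. If neither
did, let `w` reject exactly the other proposers `B`. Every woman still gets a proposal, so by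
counting at most one of `p`, `x` reaches `w`. Under `L'`, then, nobody outside `B` would be rejected
by `w`, and `p` and `x` could not both have proposed to her, although they did. -/

namespace PrefList

/-! ### Preference lists and moving a pair to the top. -/

variable {α : Type*} [DecidableEq α]

/-- `a` is strictly preferred to `b`. -/
def Prefers (L : PrefList α) (a b : α) : Prop :=
  L.toList.idxOf a < L.toList.idxOf b

theorem Prefers.ne {L : PrefList α} {a b : α} (h : L.Prefers a b) : a ≠ b := by
  rintro rfl
  exact lt_irrefl _ h

theorem Prefers.asymm {L : PrefList α} {a b : α} (h : L.Prefers a b) : ¬ L.Prefers b a :=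
  lt_asymm h

theorem prefers_or_prefers (L : PrefList α) {a b : α} (h : a ≠ b) :
    L.Prefers a b ∨ L.Prefers b a :=
  lt_or_gt_of_ne fun h' => h ((List.idxOf_inj (L.complete a)).1 h')

theorem favorite_eq_some_iff (L : PrefList α) (p : α → Prop) [DecidablePred p] (a : α) :
    L.favorite p = some a ↔ p a ∧ ∀ b, L.Prefers b a → ¬ p b := by
  unfold favorite
  rw [List.find?_eq_some_iff_getElem]
  constructor
  · rintro ⟨ha, i, hi, rfl, hlt⟩
    refine ⟨by simpa using ha, fun b hb => ?_⟩
    have hb' : L.toList.idxOf b < i := by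
      simpa [Prefers, L.nodup.idxOf_getElem] using hb
    simpa using hlt _ hb'
  · rintro ⟨ha, hb⟩
    have hi := List.idxOf_lt_length_iff.2 (L.complete a)
    refine ⟨by simpa using ha, _, hi, by simp, fun j hj => ?_⟩
    have := hb L.toList[j] (by simpa [Prefers, L.nodup.idxOf_getElem] using hj)
    simpa using this

theorem exists_favorite (L : PrefList α) {p : α → Prop} (h : ∃ a, p a) :
    ∃ a, p a ∧ ∀ b, p b → b ≠ a → L.Prefers a b := by
  classical
  obtain ⟨c, hc⟩ := h
  cases hf : L.favorite p with
  | none =>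
    have := List.find?_eq_none.1 hf c (L.complete c)
    simp [hc] at this
  | some a =>
    obtain ⟨ha, hb⟩ := (L.favorite_eq_some_iff p a).1 hf
    exact ⟨a, ha, fun b hpb hne =>
      (L.prefers_or_prefers hne).resolve_left fun h => hb b h hpb⟩

end PrefList

/-- A pair can be moved to the top two positions of a list. -/
theorem exists_mem_topTwoLists {M : Type*} [Fintype M] [DecidableEq M] (L : PrefList M) {p q : M}
    (hpq : 2 ≤ Fintype.card M → p ≠ q) :
    ∃ L' ∈ topTwoLists L, (∀ m, m ≠ p → L'.Prefers p m) ∧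
      ∀ m, m ≠ p → m ≠ q → L'.Prefers q m := by
  have hnd : ([p, q].dedup ++ L.toList.filter (fun m => decide (m ≠ p ∧ m ≠ q))).Nodup := by
    refine List.Nodup.append (List.nodup_dedup _) (L.nodup.filter _) fun m hm hm' => ?_
    simp only [List.mem_dedup, List.mem_cons, List.not_mem_nil, or_false] at hm
    simp only [List.mem_filter, decide_eq_true_eq] at hm'
    tauto
  have hc : ∀ m, m ∈ [p, q].dedup ++ L.toList.filter (fun m => decide (m ≠ p ∧ m ≠ q)) := by
    intro m
    have := L.complete m
    simp only [List.mem_append, List.mem_dedup, List.mem_cons, List.not_mem_nil, or_false,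
      List.mem_filter, decide_eq_true_eq]
    tauto
  refine ⟨⟨_, hnd, hc⟩, ⟨p, q, hpq, rfl⟩, fun m hm => ?_, fun m hm hm' => ?_⟩
  all_goals
    unfold PrefList.Prefers
    by_cases h : p = q
    · subst h
      have hd : [p, p].dedup = [p] := by simp
      simp [hd, List.idxOf_cons_ne _ (Ne.symm hm)]
    · have hd : [p, q].dedup = [p, q] := List.dedup_eq_self.2 (by simpa using h)
      first
      | simp [hd, List.idxOf_cons_ne _ (Ne.symm hm), List.idxOf_cons_ne _ (Ne.symm hm'),
          List.idxOf_cons_ne _ h]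
      | simp [hd, List.idxOf_cons_ne _ (Ne.symm hm)]

/-! ### The set of proposals as a least fixed point. -/

namespace DeferredAcceptance

variable {M W : Type*} [DecidableEq M] [DecidableEq W]

/-- With respect to the set `S` of proposals, `v` has a proposal from someone she prefers to `m`. -/
def Outranked (P : PrefProfile M W) (S : Set (M × W)) (m : M) (v : W) : Prop :=
  ∃ m', (m', v) ∈ S ∧ (P.women v).Prefers m' m

/-- The proposals `(m, v)` such that `m` has been rejected by all women whom he prefers to `v`,
where `rej S m v` says that `v`, given the proposals `S`, rejects the proposer `m`. -/
def step (men : M → PrefList W) (rej : Set (M × W) → M → W → Prop) (S : Set (M × W)) :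
    Set (M × W) :=
  {x | ∀ v, (men x.1).Prefers v x.2 → (x.1, v) ∈ S ∧ rej S x.1 v}

theorem Outranked.mono (P : PrefProfile M W) : Monotone (Outranked P) :=
  fun _ _ h _ _ ⟨m', hm', hp⟩ => ⟨m', h hm', hp⟩

/-- Rejections need comparing only for men who have proposed within `S`; the inclusions between
proposal sets below rest on this. -/
theorem step_subset_step {men : M → PrefList W} {rej rej' : Set (M × W) → M → W → Prop}
    {S T : Set (M × W)} (hST : S ⊆ T) (h : ∀ m v, (m, v) ∈ S → rej S m v → rej' T m v) :
    step men rej S ⊆ step men rej' T :=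
  fun _ hx v hv => ⟨hST (hx v hv).1, h _ _ (hx v hv).1 (hx v hv).2⟩

theorem step_mono {men : M → PrefList W} {rej : Set (M × W) → M → W → Prop}
    (hrej : Monotone rej) : Monotone (step men rej) :=
  fun _ _ hST => step_subset_step hST fun m v _ => hrej hST m v

/-- A man has proposed to at most one woman who does not reject him. -/
theorem eq_of_not_rej {men : M → PrefList W} {rej : Set (M × W) → M → W → Prop}
    {S : Set (M × W)} (hS : S ⊆ step men rej S) {m : M} {v v' : W} (h : (m, v) ∈ S)
    (h' : (m, v') ∈ S) (hr : ¬ rej S m v) (hr' : ¬ rej S m v') : v = v' := by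
  by_contra hne
  rcases (men m).prefers_or_prefers hne with hp | hp
  · exact hr (hS h' v hp).2
  · exact hr' (hS h v' hp).2

section Final

variable [Fintype M] [Fintype W]

theorem rejected_iff {P : PrefProfile M W} {S : Finset (M × W)} {m : M} {v : W} :
    Rejected P S m v ↔ (m, v) ∈ S ∧ Outranked P (S : Set (M × W)) m v := by
  unfold Rejected Outranked holds
  refine and_congr_right fun hm => ?_
  rw [Ne, PrefList.favorite_eq_some_iff]
  simp only [hm, true_and, Finset.mem_coe]
  push Not
  exact exists_congr fun _ => and_comm

theorem newProposals_subset_step (P : PrefProfile M W) (S : Finset (M × W)) :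
    (newProposals P S : Set (M × W)) ⊆ step P.men (Outranked P) S := by
  rintro ⟨m, v⟩ h v' hv'
  have h2 := ((PrefList.favorite_eq_some_iff _ _ _).1 (mem_newProposals.1 h).2).2 v' hv'
  exact rejected_iff.1 (not_not.1 h2)

theorem proposalsAfter_subset_step (P : PrefProfile M W) (k : ℕ) :
    (proposalsAfter P k : Set (M × W)) ⊆ step P.men (Outranked P) (proposalsAfter P k) := by
  induction k with
  | zero => simp [proposalsAfter]
  | succ k ih =>
    have hmono := step_mono (men := P.men) (Outranked.mono P)
      (show (proposalsAfter P k : Set (M × W)) ⊆ proposalsAfter P (k + 1) from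
        Finset.coe_subset.2 Finset.subset_union_left)
    intro x hx
    rcases Finset.mem_union.1 (Finset.mem_coe.1 hx) with h | h
    · exact hmono (ih h)
    · exact hmono (newProposals_subset_step P _ h)

theorem finalProposals_subset_step (P : PrefProfile M W) :
    (finalProposals P : Set (M × W)) ⊆ step P.men (Outranked P) (finalProposals P) :=
  proposalsAfter_subset_step P _

/-- A man still owed a proposal to `v` is either unmatched, so that the algorithm has not stopped,
or held by some `v₀`. She cannot be better than `v`, as she would have rejected him, nor worse, as
he would have passed `v` on the way to her. -/
theorem step_finalProposals_subset (P : PrefProfile M W) :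
    step P.men (Outranked P) (finalProposals P) ⊆ (finalProposals P : Set (M × W)) := by
  rintro ⟨m, v⟩ h
  by_contra hv
  have hfav : (P.men m).favorite (fun v => ¬ Rejected P (finalProposals P) m v) = some v :=
    (PrefList.favorite_eq_some_iff _ _ _).2
      ⟨fun hr => hv hr.1, fun v' hv' => not_not.2 (rejected_iff.2 (h v' hv'))⟩
  by_cases hu : Unmatched P (finalProposals P) m
  · have := mem_newProposals.2 ⟨hu, hfav⟩
    simp [newProposals_finalProposals] at this
  · obtain ⟨v₀, hv₀⟩ := not_forall.1 hu
    have hv₀ := not_not.1 hv₀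
    have hne : v₀ ≠ v := by
      rintro rfl
      exact hv (mem_of_holds hv₀)
    rcases (P.men m).prefers_or_prefers hne with hp | hp
    · exact (rejected_iff.2 (h v₀ hp)).2 hv₀
    · exact hv (finalProposals_subset_step P (mem_of_holds hv₀) v hp).1

/-- Induction on the rounds. Minimality makes the timing of proposals irrelevant: only closure has
to be checked. -/
theorem finalProposals_subset_of_step_subset {P : PrefProfile M W} {S : Set (M × W)}
    (h : step P.men (Outranked P) S ⊆ S) : (finalProposals P : Set (M × W)) ⊆ S := by
  unfold finalProposals
  generalize Nat.find (exists_newProposals_eq_empty P) = k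
  induction k with
  | zero => simp [proposalsAfter]
  | succ k ih =>
    intro x hx
    rcases Finset.mem_union.1 (Finset.mem_coe.1 hx) with hx | hx
    · exact ih hx
    · exact h (step_mono (Outranked.mono P) ih (newProposals_subset_step P _ hx))

theorem not_outranked_of_holds {P : PrefProfile M W} {S : Finset (M × W)} {m : M} {v : W}
    (h : holds P S v = some m) : ¬ Outranked P (S : Set (M × W)) m v :=
  fun ho => (rejected_iff.2 ⟨mem_of_holds h, ho⟩).2 h

theorem exists_mem_finalProposals (hcard : Fintype.card M = Fintype.card W)
    (P : PrefProfile M W) (v : W) : ∃ m, (m, v) ∈ finalProposals P := by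
  obtain ⟨m, rfl⟩ := (partner_bijective hcard P).2 v
  exact ⟨m, mem_of_holds (holds_partner hcard P m)⟩

/-- If the men's lists agree, the matching is determined by the set of all proposals. -/
theorem partner_eq_of_finalProposals_eq (hcard : Fintype.card M = Fintype.card W)
    {P Q : PrefProfile M W} (hmen : P.men = Q.men) (h : finalProposals P = finalProposals Q)
    (m : M) : partner hcard P m = partner hcard Q m := by
  have hP := holds_partner hcard P m
  have hQ := holds_partner hcard Q m
  have hmP := mem_of_holds hP
  have hmQ := mem_of_holds hQ
  by_contra hne
  -- Having reached the worse of the two women, `m` must have been rejected by the better one, who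
  -- holds him.
  rcases (P.men m).prefers_or_prefers hne with hp | hp
  · rw [← h] at hmQ
    exact not_outranked_of_holds hP (finalProposals_subset_step P hmQ _ hp).2
  · rw [h] at hmP
    rw [hmen] at hp
    exact not_outranked_of_holds hQ (finalProposals_subset_step Q hmP _ hp).2

/-! ### Profiles that differ only in the list of `w`. -/

/-- The rejection rule under which `w` rejects exactly the men in `B`, and all other women reject
the men who are not their favorite proposers. -/
def rejectExactly (P : PrefProfile M W) (w : W) (B : Set M) (S : Set (M × W)) (m : M) (v : W) :
    Prop :=
  (v = w ∧ m ∈ B) ∨ (v ≠ w ∧ Outranked P S m v)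

theorem rejectExactly_mono (P : PrefProfile M W) (w : W) (B : Set M) :
    Monotone (rejectExactly P w B) :=
  fun _ _ h m v => Or.imp_right (And.imp_right (Outranked.mono P h m v))

/-- If every woman has a proposal, then `w` has at most one proposer outside of `B`. -/
theorem eq_of_mem_of_forall_exists_mem (hcard : Fintype.card M = Fintype.card W)
    {P : PrefProfile M W} {w : W} {B : Set M} {S : Set (M × W)}
    (hS : S ⊆ step P.men (rejectExactly P w B) S) (hcov : ∀ v, ∃ m, (m, v) ∈ S) {p q : M}
    (hp : (p, w) ∈ S) (hq : (q, w) ∈ S) (hpB : p ∉ B) (hqB : q ∉ B) : p = q := by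
  -- Each woman picks a proposer she does not reject, with `w` picking `p`. The picks are distinct,
  -- so they exhaust the men and include `q`.
  have hex : ∀ v, ∃ m, (m, v) ∈ S ∧ ¬ rejectExactly P w B S m v ∧ (v = w → m = p) := by
    intro v
    by_cases hv : v = w
    · subst hv
      exact ⟨p, hp, by simp [rejectExactly, hpB], fun _ => rfl⟩
    · obtain ⟨m, hm, hbest⟩ := (P.women v).exists_favorite (hcov v)
      refine ⟨m, hm, ?_, fun h => absurd h hv⟩
      rintro (⟨h, -⟩ | ⟨-, m', hm', hpref⟩)
      · exact hv h
      · exact (hbest m' hm' hpref.ne).asymm hpref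
  choose f hfS hfr hfw using hex
  have hinj : Function.Injective f := fun v v' h =>
    eq_of_not_rej hS (hfS v) (h ▸ hfS v') (hfr v) (h ▸ hfr v')
  obtain ⟨v, hv⟩ := ((Fintype.bijective_iff_injective_and_card f).2 ⟨hinj, hcard.symm⟩).2 q
  have hvw : v = w := eq_of_not_rej hS (hv ▸ hfS v) hq (hv ▸ hfr v) (by simp [rejectExactly, hqB])
  exact (hfw v hvw).symm.trans hv

/-- Let `P` and `Q` be profiles which differ only in the list of `w`. If the top two men of `w` in
`Q` are her partner `p` under `P` and (if there are others) her second favorite among those who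
propose to her under `P`, then the same proposals are made under both profiles. -/
theorem finalProposals_eq_of_topTwo (hcard : Fintype.card M = Fintype.card W)
    {P Q : PrefProfile M W} {w : W} (hmen : Q.men = P.men)
    (hwomen : ∀ v, v ≠ w → Q.women v = P.women v) {p x : M}
    (hp : holds P (finalProposals P) w = some p)
    (hx : ∀ m, (m, w) ∈ finalProposals P → m ≠ p →
      (x, w) ∈ finalProposals P ∧ x ≠ p ∧ (m ≠ x → (P.women w).Prefers x m))
    (hpQ : ∀ m, m ≠ p → (Q.women w).Prefers p m)
    (hxQ : ∀ m, m ≠ p → m ≠ x → (Q.women w).Prefers x m) :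
    finalProposals Q = finalProposals P := by
  have hpF := mem_of_holds hp
  have hpbest : ∀ m, (m, w) ∈ finalProposals P → ¬ (P.women w).Prefers m p :=
    fun m hm h => not_outranked_of_holds hp ⟨m, hm, h⟩
  have hptop : ∀ m, (m, w) ∈ finalProposals P → m ≠ p → (P.women w).Prefers p m :=
    fun m hm h => ((P.women w).prefers_or_prefers h).resolve_left (hpbest m hm)
  have hout : ∀ (S : Set (M × W)) m v, v ≠ w → (Outranked Q S m v ↔ Outranked P S m v) := by
    intro S m v hv
    simp only [Outranked, hwomen v hv]
  -- Since `p` is among the proposals under `P`, `w` rejects all her other proposers there, and `Q`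
  -- cannot make her reject more.
  have hQP : (finalProposals Q : Set (M × W)) ⊆ finalProposals P := by
    refine finalProposals_subset_of_step_subset
      (Set.Subset.trans ?_ (step_finalProposals_subset P))
    rw [hmen]
    refine step_subset_step subset_rfl fun m v hm ho => ?_
    by_cases hv : v = w
    · subst hv
      obtain ⟨m', -, hpref⟩ := ho
      have hmp : m ≠ p := by
        rintro rfl
        exact (hpQ m' hpref.ne).asymm hpref
      exact ⟨p, hpF, hptop m hm hmp⟩
    · exact (hout _ m v hv).1 ho
  refine Finset.coe_injective (subset_antisymm hQP ?_)
  by_cases hcase : (p, w) ∈ finalProposals Q ∨ (x, w) ∈ finalProposals Q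
  · refine finalProposals_subset_of_step_subset
      (Set.Subset.trans ?_ (step_finalProposals_subset Q))
    rw [hmen]
    refine step_subset_step subset_rfl fun m v hm ho => ?_
    by_cases hv : v = w
    · subst hv
      obtain ⟨m', hm', hpref⟩ := ho
      have hmp : m ≠ p := by
        rintro rfl
        exact hpbest m' (hQP hm') hpref
      by_cases hpQF : (p, v) ∈ finalProposals Q
      · exact ⟨p, hpQF, hpQ m hmp⟩
      · refine ⟨x, hcase.resolve_left hpQF, hxQ m hmp ?_⟩
        -- By the choice of `x`, only `p` could outrank `x` under `P`, and `p` is absent here.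
        rintro rfl
        have hm'p : m' ≠ p := by
          rintro rfl
          exact hpQF hm'
        exact ((hx m' (hQP hm') hm'p).2.2 hpref.ne).asymm hpref
    · exact (hout _ m v hv).2 ho
  · exfalso
    push Not at hcase
    obtain ⟨m₀, hm₀⟩ := exists_mem_finalProposals hcard Q w
    have hm₀p : m₀ ≠ p := by
      rintro rfl
      exact hcase.1 hm₀
    obtain ⟨hxF, hxp, -⟩ := hx m₀ (hQP hm₀) hm₀p
    let B : Set M := {m | (m, w) ∈ finalProposals P ∧ m ≠ p ∧ m ≠ x}
    let Φ : Set (M × W) →o Set (M × W) :=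
      ⟨step P.men (rejectExactly P w B), step_mono (rejectExactly_mono P w B)⟩
    -- The proposals made when `w` rejects precisely the proposers under `P` other than `p` and `x`.
    let G : Set (M × W) := Φ.lfp
    have hG : step P.men (rejectExactly P w B) G = G := Φ.map_lfp
    have hGP : G ⊆ finalProposals P := by
      refine Φ.lfp_le (Set.Subset.trans ?_ (step_finalProposals_subset P))
      refine step_subset_step subset_rfl fun m v _ ho => ?_
      rcases ho with ⟨rfl, hm, hmp, -⟩ | ⟨-, ho⟩
      · exact ⟨p, hpF, hptop m hm hmp⟩
      · exact ho
    -- Intersecting with `finalProposals Q` keeps available that the men proposing to `w` all lie in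
    -- `B`.
    have hQG : (finalProposals Q : Set (M × W)) ⊆ finalProposals Q ∩ G := by
      refine finalProposals_subset_of_step_subset (Set.subset_inter ?_ ?_)
      · exact Set.Subset.trans (step_mono (Outranked.mono Q) Set.inter_subset_left)
          (step_finalProposals_subset Q)
      · refine Set.Subset.trans ?_ hG.subset
        rw [hmen]
        refine step_subset_step Set.inter_subset_right fun m v hm ho => ?_
        by_cases hv : v = w
        · subst hv
          refine Or.inl ⟨rfl, hQP hm.1, ?_, ?_⟩
          · rintro rfl
            exact hcase.1 hm.1
          · rintro rfl
            exact hcase.2 hm.1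
        · exact Or.inr ⟨hv, Outranked.mono P Set.inter_subset_right m v ((hout _ m v hv).1 ho)⟩
    have hnot : ¬ ((p, w) ∈ G ∧ (x, w) ∈ G) := by
      rintro ⟨h1, h2⟩
      refine hxp (eq_of_mem_of_forall_exists_mem hcard hG.superset (fun v => ?_) h1 h2
        (fun h => h.2.1 rfl) (fun h => h.2.2 rfl)).symm
      obtain ⟨m, hm⟩ := exists_mem_finalProposals hcard Q v
      exact ⟨m, (hQG hm).2⟩
    -- Within `G`, `w` rejects only men of `B` under `P`: nobody outranks `p`, and only `p` could
    -- outrank `x`, which `hnot` excludes.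
    have hPG : (finalProposals P : Set (M × W)) ⊆ G := by
      refine finalProposals_subset_of_step_subset (Set.Subset.trans ?_ hG.subset)
      refine step_subset_step subset_rfl fun m v hm ho => ?_
      by_cases hv : v = w
      · subst hv
        obtain ⟨m', hm', hpref⟩ := ho
        have hmp : m ≠ p := by
          rintro rfl
          exact hpbest m' (hGP hm') hpref
        refine Or.inl ⟨rfl, hGP hm, hmp, ?_⟩
        rintro rfl
        have hm'p : m' ≠ p := by
          rintro rfl
          exact hnot ⟨hm', hm⟩
        exact ((hx m' (hGP hm') hm'p).2.2 hpref.ne).asymm hpref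
      · exact Or.inr ⟨hv, ho⟩
    exact hnot ⟨hPG hpF, hPG hxF⟩

end Final

end DeferredAcceptance

open DeferredAcceptance in
theorem mainTheorem8 {M W : Type*} [Fintype M] [Fintype W] [DecidableEq M] [DecidableEq W]
    (hcard : Fintype.card M = Fintype.card W) (P : PrefProfile M W) (w : W) (L' : PrefList M) :
    ∃ L'' ∈ topTwoLists (P.women w),
      deferredAcceptance hcard (P.replaceWoman w L'') =
        deferredAcceptance hcard (P.replaceWoman w L') := by
  set P' := P.replaceWoman w L' with hP'
  obtain ⟨p, hpw⟩ := (partner_bijective hcard P').2 w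
  have hp : holds P' (finalProposals P') w = some p := hpw ▸ holds_partner hcard P' p
  -- If `p` is the only proposer, the condition on `x` is vacuous and any other man will do, or `p`
  -- himself if there is none.
  obtain ⟨x, hpx, hx⟩ : ∃ x, (2 ≤ Fintype.card M → p ≠ x) ∧
      ∀ m, (m, w) ∈ finalProposals P' → m ≠ p →
        (x, w) ∈ finalProposals P' ∧ x ≠ p ∧ (m ≠ x → (P'.women w).Prefers x m) := by
    by_cases h : ∃ m, (m, w) ∈ finalProposals P' ∧ m ≠ p
    · obtain ⟨x, ⟨hxF, hxp⟩, hbest⟩ := (P'.women w).exists_favorite h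
      exact ⟨x, fun _ => hxp.symm, fun m hm hmp => ⟨hxF, hxp, hbest m ⟨hm, hmp⟩⟩⟩
    · push Not at h
      have hex : ∃ x, 2 ≤ Fintype.card M → p ≠ x := by
        by_cases h2 : 2 ≤ Fintype.card M
        · obtain ⟨x, hx⟩ := Fintype.exists_ne_of_one_lt_card h2 p
          exact ⟨x, fun _ => hx.symm⟩
        · exact ⟨p, fun h => absurd h h2⟩
      obtain ⟨x, hx⟩ := hex
      exact ⟨x, hx, fun m hm hmp => absurd (h m hm) hmp⟩
  obtain ⟨L'', hL'', htop, hsnd⟩ := exists_mem_topTwoLists (P.women w) hpx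
  refine ⟨L'', hL'', Equiv.ext fun m => ?_⟩
  refine partner_eq_of_finalProposals_eq hcard (P := P.replaceWoman w L'') (Q := P') rfl
    (finalProposals_eq_of_topTwo (w := w) (p := p) (x := x) hcard rfl (fun v hv => ?_) hp hx ?_ ?_) m
  · simp [hP', PrefProfile.replaceWoman, hv]
  · simpa [PrefProfile.replaceWoman] using htop
  · simpa [PrefProfile.replaceWoman] using hsnd
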